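/- **Conventions.** A JC*-triple is a closed subspace $Z$ of a C*-algebra that is closed under $\{a,b,c\}=\frac12(ab^*c+cb^*a)$; a TRO is a closed subspace $T$ of a C*-algebra with $xy^*z\in T$ for all $x,y,z\in T$. Triple homomorphisms and TRO-homomorphisms are the linear maps preserving $\{x,y,z\}$, respectively $xy^*z$. The universal enveloping TRO $(T^*(Z),\rho_Z)$ of $Z$ is the TRO $T^*(Z)$ together with a triple homomorphism $\rho_Z:Z\to T^*(Z)$ such that $\rho_Z(Z)$ generates $T^*(Z)$ as a TRO and every triple homomorphism $\alpha$ from $Z$ into a TRO $S$ has the form $\alpha=f\circ\rho_Z$ with a TRO-homomorphism $f:T^*(Z)\to S$; it is unique up to TRO-isomorphism. A minimal tripotent of $Z$ is an $e\in Z$ with $\{e,e,e\}=e$ and $\{e,Z,e\}=\mathbb{C}e$. A symplectic grid in $Z$ is a family $\{u_{ij}: i,j\in I,\ i\ne j\}$ of minimal tripotents of $Z$ such that * $u_{ij}=-u_{ji}$ for $i\neq j$; * $\{u_{ij},u_{ij},u_{kl}\}=\frac12u_{kl}$ and $\{u_{kl},u_{kl},u_{ij}\}=\frac12u_{ij}$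 if $\{i,j\}\cap\{k,l\}\ne\emptyset$ and $\{i,j\}\neq\{k,l\}$; * $\{u_{kl},u_{kl},u_{ij}\}=0$ if $\{i,j\}\cap\{k,l\}=\emptyset$; * $\{u_{ij},u_{il},u_{kl}\}=\frac12u_{kj}$ for $i,j,k,l$ pairwise distinct; * all other triple products of grid elements are $0$. (Here "other" is understood up to $u_{ij}=-u_{ji}$ and $\{x,y,z\}=\{z,y,x\}$, and $\{u_{ij},u_{ij},u_{ij}\}=u_{ij}$.) **Theorem.** Let $Z$ be a JC*-triple that is linearly spanned by a symplectic grid $\{u_{ij}:i,j\in I,\ i\neq j\}$, with $10\le\dim Z<\infty$. Let $n=|I|$ and let $T$ be the TRO generated by the grid in the ambient C*-algebra. 1. For pairwise distinct $i,k,l\in I$ the element $e_{ii}:=u_{ik}u_{kl}^*u_{il}$ does not depend on $k,l$. With $e_{ij}:=e_{ii}e_{ii}^*u_{ij}e_{jj}^*e_{jj}$ for $i\ne j$, the family $(e_{ij})_{i,j\in I}$ is a system of nonzero rectangular matrix units of $T$: $e_{ij}e_{lj}^*e_{lk}=e_{ik}$; $e_{ij}e_{kl}^*e_{pq}=0$ if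 $j\neq l$ or $k\ne p$; and $T=\operatorname{lin}\{e_{ij}\}$. 2. $T^*(Z)\cong \mathbb{M}_n$, the TRO of complex $n\times n$ matrices. Precisely, there is a triple isomorphism $\rho$ of $Z$ onto the antisymmetric matrices $\{X\in\mathbb{M}_n : X^t=-X\}$ such that $(\mathbb{M}_n,\rho)$ is a universal enveloping TRO of $Z$, and for every universal enveloping TRO $(T',\sigma)$ of $Z$ there is a TRO-isomorphism $f:T'\to \mathbb{M}_n$ with $f\circ\sigma=\rho$. -/

import Mathlib

open scoped Matrix.Norms.L2Operator

universe u v w t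

/-- The Jordan triple product `{a, b, c} = (a b* c + c b* a) / 2` of a C*-algebra. -/
noncomputable def jordanTriple {A : Type*} [NonUnitalCStarAlgebra A] (a b c : A) : A :=
  (1 / 2 : ℂ) • (a * star b * c + c * star b * a)

/-- A JC*-triple system: a closed subspace of a C*-algebra that is invariant under the
Jordan triple product. -/
structure IsJCTriple {A : Type*} [NonUnitalCStarAlgebra A] (Z : Submodule ℂ A) : Prop where
  isClosed : IsClosed (Z : Set A)
  triple_mem : ∀ x ∈ Z, ∀ y ∈ Z, ∀ z ∈ Z, jordanTriple x y z ∈ Z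

/-- A ternary ring of operators: a closed subspace of a C*-algebra that is invariant under
the ternary product `x y* z`. -/
structure IsTRO {A : Type*} [NonUnitalCStarAlgebra A] (T : Submodule ℂ A) : Prop where
  isClosed : IsClosed (T : Set A)
  ternary_mem : ∀ x ∈ T, ∀ y ∈ T, ∀ z ∈ T, x * star y * z ∈ T

/-- The TRO generated by a set: the smallest TRO that contains it. -/
def troGenerated {A : Type*} [NonUnitalCStarAlgebra A] (s : Set A) : Submodule ℂ A :=
  sInf {T : Submodule ℂ A | IsTRO T ∧ s ⊆ (T : Set A)}

theorem subset_troGenerated {A : Type*} [NonUnitalCStarAlgebra A] (s : Set A) :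
    s ⊆ (troGenerated s : Set A) := by
  intro x hx
  simp only [troGenerated, SetLike.mem_coe, Submodule.mem_sInf, Set.mem_ofPred_eq]
  exact fun T hT => hT.2 hx

theorem isTRO_troGenerated {A : Type*} [NonUnitalCStarAlgebra A] (s : Set A) :
    IsTRO (troGenerated s) where
  isClosed := by
    rw [troGenerated, Submodule.coe_sInf]
    exact isClosed_biInter fun T hT => hT.1.isClosed
  ternary_mem := by
    intro x hx y hy z hz
    simp only [troGenerated, Submodule.mem_sInf, Set.mem_ofPred_eq] at hx hy hz ⊢
    exact fun T hT => hT.1.ternary_mem x (hx T hT) y (hy T hT) z (hz T hT)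

/-- A linear map between subspaces of C*-algebras is a triple homomorphism if
`φ {x, y, z} = {φ x, φ y, φ z}` for all `x, y, z` in its domain `Z`. (The hypothesis that
`w` represents `{x, y, z}` in `Z` avoids a membership proof; on a JC*-triple such a `w`
always exists.) -/
def IsTripleHom {A B : Type*} [NonUnitalCStarAlgebra A] [NonUnitalCStarAlgebra B]
    {Z : Submodule ℂ A} {W : Submodule ℂ B} (φ : Z →ₗ[ℂ] W) : Prop :=
  ∀ x y z w : Z, (w : A) = jordanTriple (x : A) y z →
    (φ w : B) = jordanTriple (φ x : B) (φ y) (φ z)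

/-- A linear map between subspaces of C*-algebras is a TRO-homomorphism if
`f (x y* z) = f x (f y)* f z` for all `x, y, z` in its domain `T`. -/
def IsTROHom {A B : Type*} [NonUnitalCStarAlgebra A] [NonUnitalCStarAlgebra B]
    {T : Submodule ℂ A} {S : Submodule ℂ B} (f : T →ₗ[ℂ] S) : Prop :=
  ∀ x y z w : T, (w : A) = (x : A) * star (y : A) * (z : A) →
    (f w : B) = (f x : B) * star (f y : B) * (f z : B)

/-- `(T, ρ)` is the universal enveloping TRO `(T*(Z), ρ_Z)` of `Z`: `T` is a TRO, generated as
a TRO by the image of the triple homomorphism `ρ : Z → T`, and every triple homomorphism from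
`Z` into a TRO `S` factors through `ρ` by a TRO-homomorphism `T → S`. -/
structure IsUniversalEnvelopingTRO {A : Type u} [NonUnitalCStarAlgebra A]
    (Z : Submodule ℂ A) {B : Type v} [NonUnitalCStarAlgebra B] (T : Submodule ℂ B)
    (ρ : Z →ₗ[ℂ] T) : Prop where
  isTRO : IsTRO T
  isTripleHom : IsTripleHom ρ
  generated : troGenerated (Set.range fun z : Z => (ρ z : B)) = T
  lift : ∀ (C : Type w) [NonUnitalCStarAlgebra C] (S : Submodule ℂ C), IsTRO S →
    ∀ α : Z →ₗ[ℂ] S, IsTripleHom α → ∃ f : T →ₗ[ℂ] S, IsTROHom f ∧ ∀ z : Z, f (ρ z) = α z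

/-- `e` is a minimal tripotent of `Z`: `{e, e, e} = e` and `{e, Z, e} = ℂ e`. -/
structure IsMinimalTripotent {A : Type*} [NonUnitalCStarAlgebra A] (Z : Submodule ℂ A)
    (e : A) : Prop where
  mem : e ∈ Z
  tripotent : jordanTriple e e e = e
  minimal : (fun z : A => jordanTriple e z e) '' (Z : Set A) = (Submodule.span ℂ {e} : Set A)

/-- A symplectic grid `{u i j : i ≠ j}` in `Z`. The values `u i i` are irrelevant. In `syg5`,
"all other triple products" are those whose index pairs, up to the symmetries
`u i j = - u j i` and `{x, y, z} = {z, y, x}`, are not of the form `{u, u, v}` and not of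
the form occurring in `syg4`. -/
structure IsSymplecticGrid {A : Type*} [NonUnitalCStarAlgebra A] (Z : Submodule ℂ A)
    {I : Type*} (u : I → I → A) : Prop where
  minimal : ∀ i j, i ≠ j → IsMinimalTripotent Z (u i j)
  syg1 : ∀ i j, i ≠ j → u i j = - u j i
  syg2 : ∀ i j k l, i ≠ j → k ≠ l → ({i, j} ∩ {k, l} : Set I).Nonempty →
    ({i, j} : Set I) ≠ {k, l} →
    jordanTriple (u i j) (u i j) (u k l) = (1 / 2 : ℂ) • u k l ∧
      jordanTriple (u k l) (u k l) (u i j) = (1 / 2 : ℂ) • u i j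
  syg3 : ∀ i j k l, i ≠ j → k ≠ l → ({i, j} ∩ {k, l} : Set I) = ∅ →
    jordanTriple (u k l) (u k l) (u i j) = 0
  syg4 : ∀ i j k l, [i, j, k, l].Nodup →
    jordanTriple (u i j) (u i l) (u k l) = (1 / 2 : ℂ) • u k j
  syg5 : ∀ a b c d p q, a ≠ b → c ≠ d → p ≠ q →
    ({a, b} : Set I) ≠ {c, d} → ({c, d} : Set I) ≠ {p, q} →
    (¬ ∃ i j k l, [i, j, k, l].Nodup ∧ ({a, b} : Set I) = {i, j} ∧
      ({c, d} : Set I) = {i, l} ∧ ({p, q} : Set I) = {k, l}) →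
    jordanTriple (u a b) (u c d) (u p q) = 0

/-- `e` is a system of (nonzero) rectangular matrix units of the TRO `T`, with a single square
block whose rows and columns are indexed by `I`. -/
structure IsSquareMatrixUnits {A : Type*} [NonUnitalCStarAlgebra A] (T : Submodule ℂ A)
    {I : Type*} (e : I → I → A) : Prop where
  ne_zero : ∀ i j, e i j ≠ 0
  mul_eq : ∀ i j k l, e i j * star (e l j) * e l k = e i k
  mul_eq_zero : ∀ i j k l p q, j ≠ l ∨ k ≠ p → e i j * star (e k l) * e p q = 0
  span_eq : Submodule.span ℂ {x | ∃ i j, x = e i j} = T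

/-! The model is `u i j = E i j - E j i` for matrix units `E`. There `E i j = u i k * star (u k l) *
u j l` for any distinct `k`, `l` outside `{i, j}`, and the proof recovers the units from this
formula.

Orthogonality in the Jordan sense splits into vanishing of one-sided products, so the grid relations
become the ternary ones of `IsSymplecticFamily`. From these alone, given an index outside any four,
the formula is independent of `k`, `l` (`unit_eq`). It yields matrix units
(`unit_mul_star_unit_mul_unit`, `unit_mul_star_unit_mul_unit_eq_zero`), and `u i j = e i j - e j i`
(`eq_unit_sub_unit`).

The relations survive every triple homomorphism, so each one into a TRO produces its own, possibly
zero, matrix units, and hence a TRO-homomorphism from the full matrices (`exists_units_lift`). For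
the inclusion of `Z` the units are nonzero, and inverting the resulting embedding on `Z` gives `ρ`.
The dimension bound enters as `5 ≤ |I|`, which supplies the spare index. -/

/-- The ternary relations satisfied by a symplectic grid in a star ring. -/
structure IsSymplecticFamily {R I : Type*} [NonUnitalRing R] [StarRing R] (u : I → I → R) :
    Prop where
  skew : ∀ i j, i ≠ j → u i j = -u j i
  tri : ∀ i j, i ≠ j → u i j * star (u i j) * u i j = u i j
  col : ∀ i j k, i ≠ j → i ≠ k → j ≠ k →
    u i j * star (u i j) * u i k + u i k * star (u i j) * u i j = u i k
  orth_left : ∀ i j k l, [i, j, k, l].Nodup → star (u i j) * u k l = 0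
  orth_right : ∀ i j k l, [i, j, k, l].Nodup → u i j * star (u k l) = 0
  sq : ∀ i j k l, [i, j, k, l].Nodup →
    u i j * star (u i l) * u k l + u k l * star (u i l) * u i j = u k j

/-- `e` is the family of matrix units that belongs to the symplectic family `u`. -/
def IsUnitsOf {R I : Type*} [NonUnitalRing R] [StarRing R] (u e : I → I → R) : Prop :=
  ∀ i j k l, k ≠ l → k ≠ i → k ≠ j → l ≠ i → l ≠ j → e i j = u i k * star (u k l) * u j l

/-! ### Matrix units from the ternary relations -/

namespace IsSymplecticFamily

variable {R I : Type*} [NonUnitalRing R] [StarRing R] {u e : I → I → R}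

theorem comp {J : Type*} (h : IsSymplecticFamily u) {φ : J → I} (hφ : Function.Injective φ) :
    IsSymplecticFamily fun i j => u (φ i) (φ j) where
  skew _ _ hij := h.skew _ _ (hφ.ne hij)
  tri _ _ hij := h.tri _ _ (hφ.ne hij)
  col _ _ _ h1 h2 h3 := h.col _ _ _ (hφ.ne h1) (hφ.ne h2) (hφ.ne h3)
  orth_left _ _ _ _ hn := h.orth_left _ _ _ _ (hn.map hφ)
  orth_right _ _ _ _ hn := h.orth_right _ _ _ _ (hn.map hφ)
  sq _ _ _ _ hn := h.sq _ _ _ _ (hn.map hφ)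

/-- The mirror symmetry: it exchanges left and right supports, so each one-sided result below yields
its counterpart on the other side. -/
theorem star_swap (h : IsSymplecticFamily u) : IsSymplecticFamily fun i j => star (u j i) where
  skew i j hij := by rw [h.skew j i hij.symm, star_neg]
  tri i j hij := by
    have := congrArg star (h.tri j i hij.symm)
    simpa [mul_assoc] using this
  col i j k h1 h2 h3 := by
    have := congrArg star (h.col i j k h1 h2 h3)
    rw [h.skew j i h1.symm, h.skew k i h2.symm]
    simp only [star_add, star_mul, star_star, mul_assoc, star_neg, mul_neg, neg_mul,
      neg_neg] at this ⊢
    rw [← neg_add, neg_inj, add_comm, this]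
  orth_left i j k l hn := by
    rw [star_star]
    exact h.orth_right _ _ _ _ (by grind)
  orth_right i j k l hn := by
    rw [star_star]
    exact h.orth_left _ _ _ _ (by grind)
  sq i j k l hn := by
    have := congrArg star (h.sq i j k l hn)
    have hh : i ≠ j ∧ i ≠ l ∧ k ≠ l ∧ k ≠ j := by grind
    rw [h.skew j i hh.1.symm, h.skew l i hh.2.1.symm, h.skew l k hh.2.2.1.symm,
      h.skew j k hh.2.2.2.symm]
    simp only [star_add, star_mul, star_star, mul_assoc, star_neg, mul_neg, neg_mul,
      neg_neg] at this ⊢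
    rw [← neg_add, neg_inj, add_comm, this]

theorem isUnitsOf_star_swap (h : IsSymplecticFamily u) (he : IsUnitsOf u e) :
    IsUnitsOf (fun i j => star (u j i)) fun i j => star (e j i) := by
  intro i j k l hkl hki hkj hli hlj
  dsimp only
  rw [he j i l k hkl.symm hlj hli hkj hki, h.skew l j hlj, h.skew k i hki]
  simp [mul_assoc]

/-- `u_ij* u_ij u_ik* = u_ik* - u_ik* u_ij u_ij*`. -/
theorem star_mul_mul_star (h : IsSymplecticFamily u) {i j k : I} (h1 : i ≠ j) (h2 : i ≠ k)
    (h3 : j ≠ k) :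
    star (u i j) * u i j * star (u i k) = star (u i k) - star (u i k) * (u i j * star (u i j)) := by
  have := congrArg star (h.col i j k h1 h2 h3)
  simp only [star_add, star_mul, star_star, mul_assoc] at this ⊢
  rw [eq_sub_iff_add_eq, add_comm, this]

/-- Expand `u j l` by `sq` through `b`. One summand dies by orthogonality, and `star_mul_mul_star`
removes `star (u k l) * u k l` from the other, up to a term that is again orthogonal. -/
theorem star_mul_eq (h : IsSymplecticFamily u) {k j l b : I} (hn : [k, j, l, b].Nodup) :
    star (u k l) * u j l = star (u k b) * u j b := by
  have h4 := h.sq k l j b (by grind)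
  have h1 := h.orth_left k l j b (by grind)
  rw [← h4, mul_add, ← mul_assoc, ← mul_assoc, ← mul_assoc, ← mul_assoc, h1,
    h.star_mul_mul_star (by grind) (by grind) (by grind), sub_mul, mul_assoc _ _ (u j b),
    mul_assoc _ _ (u j b), h1]
  simp

theorem mul_star_eq (h : IsSymplecticFamily u) {k j l b : I} (hn : [k, j, l, b].Nodup) :
    u k l * star (u j l) = u k b * star (u j b) := by
  have := h.star_swap.star_mul_eq hn
  rw [h.skew k l (by grind), h.skew j l (by grind), h.skew k b (by grind), h.skew j b (by grind)]
  simpa using this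

/-- The two auxiliary indices can be changed one at a time: `star_mul_eq` moves `l` with `k` fixed,
`mul_star_eq` moves `k` with `l` fixed. -/
theorem unit_eq (h : IsSymplecticFamily u) (hI : ∀ a b c d : I, ∃ m, m ≠ a ∧ m ≠ b ∧ m ≠ c ∧ m ≠ d)
    {i j k l k' l' : I} (hkl : k ≠ l) (hki : k ≠ i) (hkj : k ≠ j) (_hli : l ≠ i) (hlj : l ≠ j)
    (hkl' : k' ≠ l') (hki' : k' ≠ i) (hkj' : k' ≠ j) (hli' : l' ≠ i) (hlj' : l' ≠ j) :
    u i k * star (u k l) * u j l = u i k' * star (u k' l') * u j l' := by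
  have right : ∀ k l b, k ≠ j → l ≠ k → l ≠ j → b ≠ k → b ≠ j →
      u i k * star (u k l) * u j l = u i k * star (u k b) * u j b := by
    intro k l b h1 h2 h3 h4 h5
    by_cases hlb : l = b
    · rw [hlb]
    · rw [mul_assoc, mul_assoc, h.star_mul_eq (b := b) (by grind)]
  have left : ∀ k l b, k ≠ i → l ≠ k → l ≠ i → b ≠ i → b ≠ l →
      u i k * star (u k l) * u j l = u i b * star (u b l) * u j l := by
    intro k l b h1 h2 h3 h4 h5
    by_cases hlb : k = b
    · rw [hlb]
    · rw [h.skew k l h2.symm, h.skew b l h5, star_neg, star_neg, mul_neg, mul_neg,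
        h.mul_star_eq (by grind : [i, l, k, b].Nodup)]
  -- The route through the pair `(k, l')` breaks down when `k = l'`; a fifth index `m` then serves
  -- as an intermediate stop.
  by_cases hk : k = l'
  · obtain ⟨m, h1, h2, h3, h4⟩ := hI i j k k'
    rw [right k l m, left k m k', right k' m l'] <;> grind
  · rw [right k l l', left k l' k'] <;> grind

theorem exists_isUnitsOf (h : IsSymplecticFamily u)
    (hI : ∀ a b c d : I, ∃ m, m ≠ a ∧ m ≠ b ∧ m ≠ c ∧ m ≠ d) :
    ∃ e : I → I → R, IsUnitsOf u e := by
  have : ∀ i j : I, ∃ x : R, ∀ k l, k ≠ l → k ≠ i → k ≠ j → l ≠ i → l ≠ j →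
      x = u i k * star (u k l) * u j l := by
    intro i j
    obtain ⟨k, h1, h2, -, -⟩ := hI i j i j
    obtain ⟨l, h3, h4, h5, -⟩ := hI i j k k
    exact ⟨_, fun k' l' g1 g2 g3 g4 g5 =>
      h.unit_eq hI h5.symm h1 h2 h3 h4 g1 g2 g3 g4 g5⟩
  choose e he using this
  exact ⟨e, he⟩

/-- The two summands of `sq` are `e i j` and `-e j i`, once the auxiliary pair is taken in opposite
orders. -/
theorem eq_unit_sub_unit (h : IsSymplecticFamily u) (he : IsUnitsOf u e)
    (hI : ∀ a b c d : I, ∃ m, m ≠ a ∧ m ≠ b ∧ m ≠ c ∧ m ≠ d) {i j : I} (hij : i ≠ j) :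
    u i j = e i j - e j i := by
  obtain ⟨k, h1, h2, -, -⟩ := hI i j i j
  obtain ⟨l, h3, h4, h5, -⟩ := hI i j k k
  rw [he i j l k, he j i k l, ← h.sq k j i l, h.skew j k, h.skew l k] <;> try grind
  simp [add_comm, sub_eq_add_neg]

theorem mul_star_mul_unit (h : IsSymplecticFamily u) (he : IsUnitsOf u e)
    (hI : ∀ a b c d : I, ∃ m, m ≠ a ∧ m ≠ b ∧ m ≠ c ∧ m ≠ d) {i j k : I} (hik : i ≠ k) :
    u i k * star (u i k) * e i j = e i j := by
  obtain ⟨l, h1, h2, h3, -⟩ := hI i j k k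
  by_cases hkj : k = j
  · subst hkj
    obtain ⟨m, h4, h5, h6, -⟩ := hI i k l l
    have : e i k = u i k * (star (u l k) * u l k) := by
      rw [he i k m l h6 h4 h5 h1 h2, h.skew m l h6, star_neg, mul_neg,
        h.mul_star_eq (b := k) (by grind), h.skew k l h2.symm]
      simp [mul_assoc]
    rw [this, ← mul_assoc, h.tri i k hik]
  · rw [he i j k l h3.symm hik.symm hkj h1 h2, ← mul_assoc, ← mul_assoc, h.tri i k hik]

/-- The two units have left supports under those of `u i a` and `u k b`, which are orthogonal for
fresh distinct `a`, `b`. -/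
theorem star_unit_mul_unit (h : IsSymplecticFamily u) (he : IsUnitsOf u e)
    (hI : ∀ a b c d : I, ∃ m, m ≠ a ∧ m ≠ b ∧ m ≠ c ∧ m ≠ d) {i j k l : I} (hik : i ≠ k) :
    star (e i j) * e k l = 0 := by
  obtain ⟨a, h1, h2, -, -⟩ := hI i k i k
  obtain ⟨b, h3, h4, h5, -⟩ := hI i k a a
  rw [← h.mul_star_mul_unit he hI (j := j) h1.symm,
    ← h.mul_star_mul_unit he hI (j := l) h4.symm]
  have h0 := h.orth_left i a k b (by grind)
  simp only [star_mul, star_star, mul_assoc]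
  rw [← mul_assoc (star (u i a)) (u k b), h0]
  simp

theorem unit_mul_star_unit (h : IsSymplecticFamily u) (he : IsUnitsOf u e)
    (hI : ∀ a b c d : I, ∃ m, m ≠ a ∧ m ≠ b ∧ m ≠ c ∧ m ≠ d) {i j k l : I} (hjl : j ≠ l) :
    e i j * star (e k l) = 0 := by
  simpa using h.star_swap.star_unit_mul_unit (h.isUnitsOf_star_swap he) hI (j := i) (l := k) hjl

/-- With a fifth index `m`, the relation `col` splits `star (u b a)` into two parts ending in `u b
m` factors: one is killed by `u i a` on the left, the other by `u l a` on the right. -/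
theorem mul_star_mul_eq_zero (h : IsSymplecticFamily u)
    (hI : ∀ a b c d : I, ∃ m, m ≠ a ∧ m ≠ b ∧ m ≠ c ∧ m ≠ d) {i a b l : I}
    (hn : [i, a, b, l].Nodup) : u i a * star (u a b) * u l a = 0 := by
  obtain ⟨m, h1, h2, h3, h4⟩ := hI i a b l
  have h5 := h.star_mul_mul_star (i := b) (j := m) (k := a) h3.symm (by grind) h2
  have h6 := h.orth_right i a b m (by grind)
  have h7 := h.orth_left b m l a (by grind)
  have h8 : star (u b a) = star (u b m) * u b m * star (u b a) +
      star (u b a) * (u b m * star (u b m)) := by rw [h5]; abel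
  rw [h.skew a b (by grind), star_neg, h8, mul_neg, mul_add, neg_mul, add_mul]
  simp only [mul_assoc]
  rw [h7, ← mul_assoc (u i a), h6]
  simp

/-- In the model `u i a * star (u l a)` is `E i l`, so it transports row `l` to row `i`. -/
theorem mul_star_mul_unit_ne (h : IsSymplecticFamily u) (he : IsUnitsOf u e)
    (hI : ∀ a b c d : I, ∃ m, m ≠ a ∧ m ≠ b ∧ m ≠ c ∧ m ≠ d) {i l k a : I} (hil : i ≠ l)
    (hai : a ≠ i) (hal : a ≠ l) (hak : a ≠ k) :
    u i a * star (u l a) * e l k = e i k := by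
  obtain ⟨b, h1, h2, h3, h4⟩ := hI i l k a
  rw [he l k a b h4.symm hal hak h2 h3, he i k a b h4.symm hai hak h1 h3]
  have h5 := h.star_mul_mul_star (i := a) (j := l) (k := b) hal h4.symm h2.symm
  have h6 := h.mul_star_mul_eq_zero hI (i := i) (a := a) (b := b) (l := l) (by grind)
  have h7 : u i a * (star (u l a) * u l a * star (u a b)) = u i a * star (u a b) := by
    rw [h.skew l a hal.symm, star_neg, neg_mul_neg, h5, mul_sub, ← mul_assoc, ← mul_assoc,
      h.skew a l hal, mul_neg, h6]
    simp
  rw [← h7]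
  simp only [mul_assoc]

/-- For `j ≠ l` the element `e l j * star (e l j)` is a product of left projections of `u l a` and
`u l j`, and each fixes row `l`. -/
theorem unit_mul_star_unit_mul_unit_self (h : IsSymplecticFamily u) (he : IsUnitsOf u e)
    (hI : ∀ a b c d : I, ∃ m, m ≠ a ∧ m ≠ b ∧ m ≠ c ∧ m ≠ d) {l j k : I} :
    e l j * star (e l j) * e l k = e l k := by
  have key : ∀ j, j ≠ l → e l j * star (e l j) * e l k = e l k := by
    intro j hj
    obtain ⟨a, h1, h2, -, -⟩ := hI l j l j
    obtain ⟨b, h3, h4, h5, -⟩ := hI l j a a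
    have h6 : e l j = u l a * star (u l a) * u l j := by
      rw [he l j a b h5.symm h1 h2 h3 h4, mul_assoc, h.star_mul_eq (b := l) (by grind),
        h.skew a l h1, h.skew j l hj]
      simp [mul_assoc]
    have h7 : e l j * star (e l j) * e l k = u l a * star (u l a) * (u l j * star (u l j) *
        (u l a * star (u l a) * e l k)) := by
      rw [h6]; simp [mul_assoc]
    rw [h7, h.mul_star_mul_unit he hI h1.symm, h.mul_star_mul_unit he hI hj.symm,
      h.mul_star_mul_unit he hI h1.symm]
  by_cases hj : j = l
  · subst hj
    obtain ⟨m, h1, -, -, -⟩ := hI j j j j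
    obtain ⟨a, h2, h3, -, -⟩ := hI j m j m
    -- Column transport, the mirror of row transport, gives `e j j * star (e j j) = e j m * star (e
    -- j m)`, reducing to the off-diagonal case.
    have s1 := h.star_swap.mul_star_mul_unit_ne (h.isUnitsOf_star_swap he) hI
      (i := j) (l := m) (k := j) (a := a) h1.symm h2 h3 h2
    have s2 := congrArg star (h.star_swap.mul_star_mul_unit_ne (h.isUnitsOf_star_swap he) hI
      (i := m) (l := j) (k := j) (a := a) h1 h3 h2 h2)
    simp only [star_mul, star_star] at s1 s2
    rw [← s1, ← mul_assoc (e j j), s2, key m h1]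
  · exact key j hj

theorem unit_mul_star_unit_mul_unit (h : IsSymplecticFamily u) (he : IsUnitsOf u e)
    (hI : ∀ a b c d : I, ∃ m, m ≠ a ∧ m ≠ b ∧ m ≠ c ∧ m ≠ d) (i j l k : I) :
    e i j * star (e l j) * e l k = e i k := by
  by_cases hil : i = l
  · subst hil
    exact h.unit_mul_star_unit_mul_unit_self he hI
  · obtain ⟨a, h1, h2, h3, h4⟩ := hI i l j k
    rw [← h.mul_star_mul_unit_ne he hI hil h1 h2 h3, mul_assoc, mul_assoc,
      ← mul_assoc (e l j), h.unit_mul_star_unit_mul_unit_self he hI,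
      h.mul_star_mul_unit_ne he hI hil h1 h2 h4]

theorem unit_eq_mul (h : IsSymplecticFamily u) (he : IsUnitsOf u e)
    (hI : ∀ a b c d : I, ∃ m, m ≠ a ∧ m ≠ b ∧ m ≠ c ∧ m ≠ d) {i j : I} (hij : i ≠ j) :
    e i j = e i i * star (e i i) * u i j * star (e j j) * e j j := by
  rw [h.eq_unit_sub_unit he hI hij, mul_sub, h.unit_mul_star_unit_mul_unit he hI, mul_assoc _ _ (e j i),
    h.star_unit_mul_unit he hI hij, mul_zero, sub_zero, h.unit_mul_star_unit_mul_unit he hI]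

theorem unit_mul_star_unit_mul_unit_eq_zero (h : IsSymplecticFamily u) (he : IsUnitsOf u e)
    (hI : ∀ a b c d : I, ∃ m, m ≠ a ∧ m ≠ b ∧ m ≠ c ∧ m ≠ d) (i j k l p q : I)
    (hne : j ≠ l ∨ k ≠ p) : e i j * star (e k l) * e p q = 0 := by
  rcases hne with hne | hne
  · rw [h.unit_mul_star_unit he hI hne, zero_mul]
  · rw [mul_assoc, h.star_unit_mul_unit he hI hne, mul_zero]

end IsSymplecticFamily

/-! ### From Jordan relations to ternary relations -/

section JordanTriple

variable {A : Type*} [NonUnitalCStarAlgebra A]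

theorem two_smul_jordanTriple (a b c : A) :
    (2 : ℂ) • jordanTriple a b c = a * star b * c + c * star b * a := by
  rw [jordanTriple, smul_smul]
  norm_num

theorem add_eq_of_jordanTriple_eq {a b c d : A} (h : jordanTriple a b c = (1 / 2 : ℂ) • d) :
    a * star b * c + c * star b * a = d := by
  rw [← two_smul_jordanTriple, h, smul_smul]
  norm_num

theorem jordanTriple_self (a b : A) : jordanTriple a b a = a * star b * a := by
  rw [jordanTriple, ← two_smul ℂ, smul_smul]
  norm_num

/-- Orthogonality of a tripotent `a` to `c` in the Jordan sense is orthogonality of ranges and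
of supports. -/
theorem star_mul_eq_zero_and_mul_star_eq_zero {a c : A} (ha : a * star a * a = a)
    (h : jordanTriple a a c = 0) : star a * c = 0 ∧ c * star a = 0 := by
  have h1 : a * star a * c + c * star a * a = 0 := by
    rw [← two_smul_jordanTriple, h, smul_zero]
  -- With `p = a * star a` and `q = star a * a`, the hypothesis is `pc + cq = 0`. Multiplying by `p`
  -- on the left gives `pc + pcq = 0`, and by `q` on the right `pcq = -cq = pc`; hence `2pc = 0`.
  have h2 : a * star a * c + a * star a * (c * star a * a) = 0 := by
    have h3 := congrArg (fun x => a * star a * x) h1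
    simp only [mul_add, mul_zero] at h3
    rwa [← mul_assoc (a * star a) (a * star a) c, ← mul_assoc (a * star a) a, ha] at h3
  have h4 : c * star a * a = -(a * star a * c) := (neg_eq_of_add_eq_zero_right h1).symm
  have h5 : c * star a * a * (star a * a) = c * star a * a := by
    rw [← mul_assoc, mul_assoc (c * star a), mul_assoc c, ← mul_assoc (star a)]
    have := congrArg star ha
    simp only [star_mul, star_star] at this
    rw [mul_assoc (star a), this]
  have h6 : a * star a * (c * star a * a) = -(c * star a * a) := by
    calc a * star a * (c * star a * a) = a * star a * c * (star a * a) := by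
          simp only [mul_assoc]
      _ = -(c * star a * a) := by
          rw [eq_neg_of_add_eq_zero_left h1, neg_mul, h5]
  have h7 : a * star a * c = 0 := by
    rw [h6, h4, neg_neg, ← two_smul ℂ] at h2
    exact (smul_eq_zero.mp h2).resolve_left two_ne_zero
  have h8 : c * star a * a = 0 := by rw [h4, h7, neg_zero]
  have h9 : star a * a * star a = star a := by
    simpa [mul_assoc] using congrArg star ha
  constructor
  · rw [← h9, mul_assoc, mul_assoc, ← mul_assoc a, h7, mul_zero]
  · rw [← h9, ← mul_assoc, ← mul_assoc, h8, zero_mul]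

end JordanTriple

namespace IsSymplecticGrid

variable {A : Type*} [NonUnitalCStarAlgebra A] {Z : Submodule ℂ A} {I : Type*} {u : I → I → A}

/-- The image of a symplectic grid under a triple homomorphism is a symplectic family. -/
theorem isSymplecticFamily (hu : IsSymplecticGrid Z u) {C : Type*} [NonUnitalCStarAlgebra C]
    {S : Submodule ℂ C} {α : Z →ₗ[ℂ] S} (hα : IsTripleHom α) {z : I → I → Z}
    (hz : ∀ i j, i ≠ j → (z i j : A) = u i j) :
    IsSymplecticFamily fun i j => (α (z i j) : C) := by
  have key : ∀ a b c d p q r s : I, a ≠ b → c ≠ d → p ≠ q → r ≠ s → ∀ t : ℂ,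
      jordanTriple (u a b) (u c d) (u p q) = t • u r s →
      jordanTriple (α (z a b) : C) (α (z c d)) (α (z p q)) = t • (α (z r s) : C) := by
    intro a b c d p q r s hab hcd hpq hrs t h
    rw [← hα (z a b) (z c d) (z p q) (t • z r s)]
    · simp
    · rw [hz _ _ hab, hz _ _ hcd, hz _ _ hpq, ← hz _ _ hrs] at *
      rw [h]; rfl
  have tri : ∀ i j, i ≠ j → (α (z i j) : C) * star (α (z i j) : C) * α (z i j) = α (z i j) := by
    intro i j h
    have := key i j i j i j i j h h h h 1 (by rw [(hu.minimal i j h).tripotent, one_smul])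
    rwa [one_smul, jordanTriple_self] at this
  have orth : ∀ i j k l, [i, j, k, l].Nodup →
      star (α (z i j) : C) * α (z k l) = 0 ∧ (α (z k l) : C) * star (α (z i j) : C) = 0 := by
    intro i j k l hn
    have hij : i ≠ j := by grind
    have hkl : k ≠ l := by grind
    refine star_mul_eq_zero_and_mul_star_eq_zero (tri i j hij) ?_
    have := key i j i j k l k l hij hij hkl hkl 0 (by
      rw [zero_smul]
      refine hu.syg3 k l i j hkl hij ?_
      ext x
      simp only [Set.mem_inter_iff, Set.mem_insert_iff, Set.mem_singleton_iff,
        Set.mem_empty_iff_false]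
      grind)
    rwa [zero_smul] at this
  refine ⟨?_, tri, ?_, fun i j k l hn => (orth i j k l hn).1, ?_, ?_⟩
  · intro i j h
    have : z i j = -z j i := by
      ext
      rw [hz i j h, Submodule.coe_neg, hz j i h.symm, hu.syg1 i j h]
    rw [this, map_neg, Submodule.coe_neg]
  · intro i j k hij hik hjk
    refine add_eq_of_jordanTriple_eq (key i j i j i k i k hij hij hik hik _ ?_)
    refine (hu.syg2 i j i k hij hik ⟨i, by simp⟩ ?_).1
    intro h
    have : j ∈ ({i, k} : Set I) := h ▸ (by simp)
    simp only [Set.mem_insert_iff, Set.mem_singleton_iff] at this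
    grind
  · intro i j k l hn
    exact (orth k l i j (by grind)).2
  · intro i j k l hn
    exact add_eq_of_jordanTriple_eq (key i j i l k l k j (by grind) (by grind) (by grind)
      (by grind) _ (hu.syg4 i j k l hn))

end IsSymplecticGrid

/-! ### Matrix units as homomorphisms from the matrix TRO -/

/-- The multiplication rules of a square system of matrix units. -/
structure IsTernaryUnits {R I : Type*} [NonUnitalRing R] [StarRing R] (e : I → I → R) : Prop where
  mul_eq : ∀ i j k l, e i j * star (e l j) * e l k = e i k
  mul_eq_zero : ∀ i j k l p q, j ≠ l ∨ k ≠ p → e i j * star (e k l) * e p q = 0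

theorem IsSymplecticFamily.isTernaryUnits {R I : Type*} [NonUnitalRing R] [StarRing R]
    {u e : I → I → R} (h : IsSymplecticFamily u) (he : IsUnitsOf u e)
    (hI : ∀ a b c d : I, ∃ m, m ≠ a ∧ m ≠ b ∧ m ≠ c ∧ m ≠ d) : IsTernaryUnits e :=
  ⟨fun i j k l => h.unit_mul_star_unit_mul_unit he hI i j l k,
    h.unit_mul_star_unit_mul_unit_eq_zero he hI⟩

theorem IsTernaryUnits.eq_zero {R I : Type*} [NonUnitalRing R] [StarRing R] {e : I → I → R}
    (he : IsTernaryUnits e) {i j : I} (h : e i j = 0) (k l : I) : e k l = 0 := by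
  rw [← he.mul_eq k j l i, ← he.mul_eq i j l i, h]
  simp

/-- The linear map from matrices that is given by a system of matrix units. -/
noncomputable def matrixMap {R ι : Type*} [Fintype ι] [AddCommGroup R] [Module ℂ R]
    (e : ι → ι → R) : Matrix ι ι ℂ →ₗ[ℂ] R where
  toFun X := ∑ i, ∑ j, X i j • e i j
  map_add' X Y := by simp [add_smul, Finset.sum_add_distrib]
  map_smul' c X := by simp [mul_smul, Finset.smul_sum]

section MatrixMap

variable {ι : Type*} [Fintype ι] [DecidableEq ι]

theorem matrixMap_single {R : Type*} [AddCommGroup R] [Module ℂ R] (e : ι → ι → R) (i j : ι)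
    (c : ℂ) : matrixMap e (Matrix.single i j c) = c • e i j := by
  change ∑ k, ∑ l, Matrix.single i j c k l • e k l = _
  rw [Finset.sum_eq_single i, Finset.sum_eq_single j]
  · simp
  · intro b _ hb
    simp [hb.symm]
  · simp
  · intro b _ hb
    refine Finset.sum_eq_zero fun l _ => ?_
    simp [hb.symm]
  · simp

variable {C : Type*} [NonUnitalCStarAlgebra C] {e : ι → ι → C}

theorem IsTernaryUnits.matrixMap_mul (he : IsTernaryUnits e) (X Y W : Matrix ι ι ℂ) :
    matrixMap e (X * star Y * W) = matrixMap e X * star (matrixMap e Y) * matrixMap e W := by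
  induction X using Matrix.induction_on' with
  | h_zero => simp
  | h_add p q hp hq => simp only [add_mul, map_add, hp, hq]
  | h_std_basis i j a =>
  induction Y using Matrix.induction_on' with
  | h_zero => simp
  | h_add p q hp hq => simp only [add_mul, mul_add, map_add, star_add, hp, hq]
  | h_std_basis k l b =>
  induction W using Matrix.induction_on' with
  | h_zero => simp
  | h_add p q hp hq => simp only [mul_add, map_add, hp, hq]
  | h_std_basis p q c =>
  rw [Matrix.star_eq_conjTranspose, Matrix.conjTranspose_single, matrixMap_single,
    matrixMap_single, matrixMap_single, star_smul, smul_mul_smul_comm, smul_mul_smul_comm]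
  by_cases hjl : j = l
  · subst hjl
    rw [Matrix.single_mul_single_same]
    by_cases hkp : k = p
    · subst hkp
      rw [Matrix.single_mul_single_same, matrixMap_single, he.mul_eq]
    · rw [Matrix.single_mul_single_of_ne _ _ _ _ hkp, he.mul_eq_zero _ _ _ _ _ _ (Or.inr hkp)]
      simp
  · rw [Matrix.single_mul_single_of_ne _ _ _ _ hjl, he.mul_eq_zero _ _ _ _ _ _ (Or.inl hjl)]
    simp

theorem IsTernaryUnits.matrixMap_injective (he : IsTernaryUnits e) (hne : ∀ i j, e i j ≠ 0) :
    Function.Injective (matrixMap e) := by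
  rw [injective_iff_map_eq_zero]
  intro X hX
  ext i j
  -- Compression isolates the entry `X i j`; the redundant starred factors make it an iterated
  -- ternary product, which `matrixMap e` respects.
  have h1 : matrixMap e (Matrix.single i i 1 * star (Matrix.single i i 1) * X *
      star (Matrix.single j j 1) * Matrix.single j j 1) = 0 := by
    rw [he.matrixMap_mul, he.matrixMap_mul, hX]
    simp
  rw [Matrix.star_eq_conjTranspose, Matrix.conjTranspose_single, Matrix.star_eq_conjTranspose,
    Matrix.conjTranspose_single, Matrix.single_mul_single_same, Matrix.single_mul_mul_single,
    Matrix.single_mul_single_same, matrixMap_single] at h1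
  simpa [hne i j] using h1

theorem range_matrixMap {R : Type*} [AddCommGroup R] [Module ℂ R] (e : ι → ι → R) :
    LinearMap.range (matrixMap e) = Submodule.span ℂ {x | ∃ i j, x = e i j} := by
  apply le_antisymm
  · rintro _ ⟨X, rfl⟩
    exact Submodule.sum_mem _ fun i _ => Submodule.sum_mem _ fun j _ =>
      Submodule.smul_mem _ _ (Submodule.subset_span ⟨i, j, rfl⟩)
  · rw [Submodule.span_le]
    rintro _ ⟨i, j, rfl⟩
    exact ⟨Matrix.single i j 1, by rw [matrixMap_single, one_smul]⟩

theorem IsTernaryUnits.isTRO_range (he : IsTernaryUnits e) :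
    IsTRO (LinearMap.range (matrixMap e)) where
  isClosed := Submodule.closed_of_finiteDimensional _
  ternary_mem := by
    rintro _ ⟨X, rfl⟩ _ ⟨Y, rfl⟩ _ ⟨W, rfl⟩
    exact ⟨X * star Y * W, he.matrixMap_mul X Y W⟩

theorem troGenerated_le {A : Type*} [NonUnitalCStarAlgebra A] {s : Set A} {T : Submodule ℂ A}
    (hT : IsTRO T) (h : s ⊆ T) : troGenerated s ≤ T :=
  sInf_le ⟨hT, h⟩

end MatrixMap

/-! ### Size and nondegeneracy of the grid -/

namespace IsSymplecticGrid

variable {A : Type*} [NonUnitalCStarAlgebra A] {Z : Submodule ℂ A} {I : Type*} {u : I → I → A}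

theorem exists_lift (hu : IsSymplecticGrid Z u) :
    ∃ z : I → I → Z, ∀ i j, i ≠ j → (z i j : A) = u i j := by
  classical
  refine ⟨fun i j => if h : i ≠ j then ⟨u i j, (hu.minimal i j h).mem⟩ else 0, fun i j h => ?_⟩
  simp [h]

theorem span_lift (hspan : Submodule.span ℂ {x | ∃ i j, i ≠ j ∧ x = u i j} = Z)
    {z : I → I → Z} (hz : ∀ i j, i ≠ j → (z i j : A) = u i j) :
    Submodule.span ℂ {x | ∃ i j, i ≠ j ∧ x = z i j} = ⊤ := by
  apply Submodule.map_injective_of_injective Z.injective_subtype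
  rw [Submodule.map_span, Submodule.map_top, Submodule.range_subtype]
  conv_rhs => rw [← hspan]
  congr 1
  ext x
  constructor
  · rintro ⟨_, ⟨i, j, hij, rfl⟩, rfl⟩
    exact ⟨i, j, hij, hz i j hij⟩
  · rintro ⟨i, j, hij, rfl⟩
    exact ⟨z i j, ⟨i, j, hij, rfl⟩, hz i j hij⟩

theorem linearMap_ext (hspan : Submodule.span ℂ {x | ∃ i j, i ≠ j ∧ x = u i j} = Z)
    {z : I → I → Z} (hz : ∀ i j, i ≠ j → (z i j : A) = u i j) {M : Type*} [AddCommGroup M]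
    [Module ℂ M] {f g : Z →ₗ[ℂ] M} (h : ∀ i j, i ≠ j → f (z i j) = g (z i j)) : f = g := by
  refine LinearMap.ext_on (span_lift hspan hz) ?_
  rintro _ ⟨i, j, hij, rfl⟩
  exact h i j hij

theorem isTripleHom_id : IsTripleHom (LinearMap.id : Z →ₗ[ℂ] Z) := fun _ _ _ _ h => h

theorem family (hu : IsSymplecticGrid Z u) {z : I → I → Z}
    (hz : ∀ i j, i ≠ j → (z i j : A) = u i j) : IsSymplecticFamily fun i j => (z i j : A) :=
  hu.isSymplecticFamily isTripleHom_id hz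

theorem mul_star_mul_eq_zero (hu : IsSymplecticGrid Z u) {i j k : I} (hij : i ≠ j) (hik : i ≠ k)
    (hjk : j ≠ k) : u i j * star (u i k) * u i j = 0 := by
  rw [← jordanTriple_self]
  have hne : ({i, j} : Set I) ≠ {i, k} := by
    intro h
    have : j ∈ ({i, k} : Set I) := h ▸ (by simp)
    simp only [Set.mem_insert_iff, Set.mem_singleton_iff] at this
    grind
  refine hu.syg5 i j i k i j hij hik hij hne hne.symm ?_
  rintro ⟨a, b, c, d, hn, h1, -, h2⟩
  have : a ∈ ({c, d} : Set I) := by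
    rw [← h2, h1]; simp
  simp only [Set.mem_insert_iff, Set.mem_singleton_iff] at this
  grind

/-- The definition of a minimal tripotent admits `0`, so nonvanishing has to be propagated along the
grid by `syg2`. -/
theorem ne_zero_of_ne_zero (hu : IsSymplecticGrid Z u) {i j k : I} (hij : i ≠ j) (hik : i ≠ k)
    (h : u i j ≠ 0) : u i k ≠ 0 := by
  by_cases hjk : j = k
  · rwa [← hjk]
  intro h0
  have h1 := (hu.syg2 i j i k hij hik ⟨i, by simp⟩ (by
    intro h
    have : j ∈ ({i, k} : Set I) := h ▸ (by simp)
    simp only [Set.mem_insert_iff, Set.mem_singleton_iff] at this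
    grind)).2
  rw [h0, show jordanTriple 0 0 (u i j) = 0 by simp [jordanTriple]] at h1
  exact h ((smul_eq_zero.mp h1.symm).resolve_left (by norm_num))

/-- A symplectic grid that spans a nonzero finite-dimensional space is finite. -/
theorem finite (hu : IsSymplecticGrid Z u) [FiniteDimensional ℂ Z] {i j : I} (hij : i ≠ j)
    (h0 : u i j ≠ 0) : Finite I := by
  obtain ⟨z, hz⟩ := hu.exists_lift
  have hF := hu.family hz
  classical
  have hli : LinearIndependent ℂ fun k : {k : I // i ≠ k} => z i k := by
    rw [linearIndependent_iff']
    intro s g hg k hk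
    -- This conjugate-linear map fixes `u i k` and kills the other members of row `i`, so it
    -- isolates one coefficient.
    have h1 := congrArg (fun x : Z => u i k * star (x : A) * u i k) hg
    simp only [Submodule.coe_sum, Submodule.coe_smul, star_sum, star_smul, Finset.mul_sum,
      Finset.sum_mul, ZeroMemClass.coe_zero, star_zero, mul_zero, zero_mul] at h1
    rw [Finset.sum_eq_single k] at h1
    · have h2 := hF.tri i k k.2
      rw [hz i k k.2] at h1 h2
      rw [mul_smul_comm, smul_mul_assoc, h2] at h1
      simpa [hu.ne_zero_of_ne_zero hij k.2 h0] using h1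
    · intro l _ hl
      rw [hz i l l.2, mul_smul_comm, smul_mul_assoc,
        hu.mul_star_mul_eq_zero k.2 l.2 (fun h => hl (Subtype.ext h.symm)), smul_zero]
    · exact fun h => absurd hk h
  have := hli.finite
  have h2 : Finite {k : I // ¬ i ≠ k} := by
    refine Finite.of_injective (fun _ => ()) ?_
    rintro ⟨a, ha⟩ ⟨b, hb⟩ -
    simp only [ne_eq, not_not] at ha hb
    simp [← ha, ← hb]
  exact Finite.of_equiv _ (Equiv.sumCompl fun k : I => i ≠ k)

theorem card_lt_pairs : ∀ n : ℕ, n < 5 → Fintype.card {p : Fin n × Fin n // p.1 < p.2} < 10 := by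
  decide

theorem exists_ne_zero (hspan : Submodule.span ℂ {x | ∃ i j, i ≠ j ∧ x = u i j} = Z)
    (hdim : 10 ≤ Module.finrank ℂ Z) : ∃ i j, i ≠ j ∧ u i j ≠ 0 := by
  by_contra! h
  have : Z = ⊥ := by
    rw [← hspan, Submodule.span_eq_bot]
    rintro _ ⟨i, j, hij, rfl⟩
    exact h i j hij
  subst this
  simp at hdim

/-- By skew symmetry the pairs `i < j` already span, so the dimension is at most `n(n-1)/2`, which
is below `10` for `n < 5`. -/
theorem finite_and_five_le_card (hu : IsSymplecticGrid Z u)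
    (hspan : Submodule.span ℂ {x | ∃ i j, i ≠ j ∧ x = u i j} = Z)
    (hdim : 10 ≤ Module.finrank ℂ Z) : Finite I ∧ 5 ≤ Nat.card I := by
  have hfd : FiniteDimensional ℂ Z := Module.finite_of_finrank_pos (by omega)
  obtain ⟨i, j, hij, h0⟩ := exists_ne_zero hspan hdim
  have hfin : Finite I := hu.finite hij h0
  refine ⟨hfin, ?_⟩
  by_contra! hlt
  let φ := (Finite.equivFin I).symm
  have hle : Submodule.span ℂ {x | ∃ i j, i ≠ j ∧ x = u i j} = Submodule.span ℂ
      (Set.range fun p : {p : Fin (Nat.card I) × Fin (Nat.card I) // p.1 < p.2} =>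
        u (φ p.1.1) (φ p.1.2)) := by
    apply le_antisymm
    · rw [Submodule.span_le]
      rintro _ ⟨i, j, hij, rfl⟩
      rcases lt_or_gt_of_ne (φ.symm.injective.ne hij) with h | h
      · exact Submodule.subset_span ⟨⟨(φ.symm i, φ.symm j), h⟩, by simp⟩
      · rw [hu.syg1 i j hij]
        exact Submodule.neg_mem _
          (Submodule.subset_span ⟨⟨(φ.symm j, φ.symm i), h⟩, by simp⟩)
    · refine Submodule.span_mono ?_
      rintro _ ⟨p, rfl⟩
      exact ⟨_, _, φ.injective.ne p.2.ne, rfl⟩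
  have h1 := finrank_range_le_card (R := ℂ)
    fun p : {p : Fin (Nat.card I) × Fin (Nat.card I) // p.1 < p.2} => u (φ p.1.1) (φ p.1.2)
  rw [Set.finrank, ← hle, hspan] at h1
  have := card_lt_pairs _ hlt
  omega

theorem exists_ne_of_five_le_card {J : Type*} [Finite J] (h : 5 ≤ Nat.card J) (a b c d : J) :
    ∃ m, m ≠ a ∧ m ≠ b ∧ m ≠ c ∧ m ≠ d := by
  classical
  have := Fintype.ofFinite J
  rw [Nat.card_eq_fintype_card] at h
  obtain ⟨m, hm⟩ := Finset.exists_mem_notMem_of_card_lt_card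
    (s := ({a, b, c, d} : Finset J)) (t := Finset.univ)
    (lt_of_le_of_lt Finset.card_le_four (by rw [Finset.card_univ]; omega))
  exact ⟨m, by simpa using hm.2⟩

/-! ### The TRO generated by the grid -/

theorem unit_ne_zero (hspan : Submodule.span ℂ {x | ∃ i j, i ≠ j ∧ x = u i j} = Z)
    (hdim : 10 ≤ Module.finrank ℂ Z) {z : I → I → Z} (hz : ∀ i j, i ≠ j → (z i j : A) = u i j)
    {e : I → I → A} (he : IsTernaryUnits e) (hue : ∀ i j, i ≠ j → (z i j : A) = e i j - e j i)
    (i j : I) : e i j ≠ 0 := by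
  intro h0
  obtain ⟨k, l, hkl, h⟩ := exists_ne_zero hspan hdim
  rw [← hz k l hkl, hue k l hkl, he.eq_zero h0, he.eq_zero h0, sub_zero] at h
  exact h rfl

/-- The matrix units of the TRO that is generated by a symplectic grid. -/
theorem isSquareMatrixUnits [Finite I] (hu : IsSymplecticGrid Z u)
    (hspan : Submodule.span ℂ {x | ∃ i j, i ≠ j ∧ x = u i j} = Z)
    (hdim : 10 ≤ Module.finrank ℂ Z)
    (hI : ∀ a b c d : I, ∃ m, m ≠ a ∧ m ≠ b ∧ m ≠ c ∧ m ≠ d) :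
    ∃ e : I → I → A,
      (∀ i k l, [i, k, l].Nodup → e i i = u i k * star (u k l) * u i l) ∧
      (∀ i j, i ≠ j → e i j = e i i * star (e i i) * u i j * star (e j j) * e j j) ∧
      IsSquareMatrixUnits (troGenerated {x | ∃ i j, i ≠ j ∧ x = u i j}) e := by
  classical
  have := Fintype.ofFinite I
  obtain ⟨z, hz⟩ := hu.exists_lift
  have hF := hu.family hz
  obtain ⟨e, he⟩ := hF.exists_isUnitsOf hI
  have hT := hF.isTernaryUnits he hI
  have hue : ∀ i j, i ≠ j → (z i j : A) = e i j - e j i :=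
    fun i j hij => hF.eq_unit_sub_unit he hI hij
  refine ⟨e, ?_, ?_, unit_ne_zero hspan hdim hz hT hue, hT.mul_eq, hT.mul_eq_zero, ?_⟩
  · intro i k l hn
    have h : i ≠ k ∧ k ≠ l ∧ i ≠ l := by grind
    rw [he i i k l h.2.1 h.1.symm h.1.symm h.2.2.symm h.2.2.symm]
    dsimp only
    rw [hz i k h.1, hz k l h.2.1, hz i l h.2.2]
  · intro i j hij
    rw [← hz i j hij]
    exact hF.unit_eq_mul he hI hij
  · rw [← range_matrixMap]
    apply le_antisymm
    · rw [range_matrixMap, Submodule.span_le]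
      rintro _ ⟨i, j, rfl⟩
      obtain ⟨k, h1, h2, -, -⟩ := hI i j i j
      obtain ⟨l, h3, h4, h5, -⟩ := hI i j k k
      rw [he i j k l h5.symm h1 h2 h3 h4]
      have hmem : ∀ i j, i ≠ j → (z i j : A) ∈
          troGenerated {x | ∃ i j, i ≠ j ∧ x = u i j} := fun i j h =>
        subset_troGenerated _ ⟨i, j, h, hz i j h⟩
      exact (isTRO_troGenerated _).ternary_mem _ (hmem _ _ h1.symm) _ (hmem _ _ h5.symm) _
        (hmem _ _ h4.symm)
    · refine troGenerated_le hT.isTRO_range ?_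
      rintro _ ⟨i, j, hij, rfl⟩
      rw [← hz i j hij, hue i j hij, range_matrixMap]
      exact Submodule.sub_mem _ (Submodule.subset_span ⟨i, j, rfl⟩)
        (Submodule.subset_span ⟨j, i, rfl⟩)

end IsSymplecticGrid

theorem IsTernaryUnits.matrixMap_jordanTriple {ι C : Type*} [Fintype ι] [DecidableEq ι]
    [NonUnitalCStarAlgebra C] {e : ι → ι → C} (he : IsTernaryUnits e) (X Y W : Matrix ι ι ℂ) :
    matrixMap e (jordanTriple X Y W) =
      jordanTriple (matrixMap e X) (matrixMap e Y) (matrixMap e W) := by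
  rw [jordanTriple, jordanTriple, map_smul, map_add, he.matrixMap_mul, he.matrixMap_mul]

/-! ### Antisymmetric matrices and extension of triple homomorphisms -/

namespace IsSymplecticGrid

variable {A : Type*} [NonUnitalCStarAlgebra A] {Z : Submodule ℂ A} {I : Type*} {u : I → I → A}
  {ι : Type*} [Fintype ι] [DecidableEq ι] {z : I → I → Z}

/-- The antisymmetric matrices lie in every subspace that contains the matrices
`E i j - E j i`. -/
theorem mem_of_transpose_eq_neg {V : Submodule ℂ (Matrix ι ι ℂ)}
    (hV : ∀ i j, i ≠ j → Matrix.single i j (1 : ℂ) - Matrix.single j i 1 ∈ V)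
    {X : Matrix ι ι ℂ} (hX : X.transpose = -X) : X ∈ V := by
  -- This is `X = (X - Xᵗ) / 2`, expanded in matrix units.
  have h1 : X = (1 / 2 : ℂ) • ∑ i, ∑ j, X i j • (Matrix.single i j (1 : ℂ) -
      Matrix.single j i 1) := by
    have h2 : ∑ i, ∑ j, X i j • Matrix.single i j (1 : ℂ) = X := by
      conv_rhs => rw [Matrix.matrix_eq_sum_single X]
      simp [Matrix.smul_single]
    have h3 : ∑ i, ∑ j, X i j • Matrix.single j i (1 : ℂ) = -X := by
      rw [Finset.sum_comm, ← hX]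
      conv_rhs => rw [Matrix.matrix_eq_sum_single X.transpose]
      simp [Matrix.smul_single]
    simp only [smul_sub, Finset.sum_sub_distrib] at h2 h3 ⊢
    rw [h2, h3, ← smul_sub, sub_neg_eq_add, ← two_smul ℂ, smul_smul]
    norm_num
  rw [h1]
  refine V.smul_mem _ (V.sum_mem fun i _ => V.sum_mem fun j _ => V.smul_mem _ ?_)
  by_cases hij : i = j
  · simp [hij]
  · exact hV i j hij

/-- The representation of a space that is spanned by a symplectic grid on the antisymmetric
matrices. -/
theorem exists_antisymmetric (hu : IsSymplecticGrid Z u)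
    (hspan : Submodule.span ℂ {x | ∃ i j, i ≠ j ∧ x = u i j} = Z)
    (hdim : 10 ≤ Module.finrank ℂ Z)
    (hI : ∀ a b c d : ι, ∃ m, m ≠ a ∧ m ≠ b ∧ m ≠ c ∧ m ≠ d)
    (hz : ∀ i j, i ≠ j → (z i j : A) = u i j) (φ : ι ≃ I) :
    ∃ ρ : Z →ₗ[ℂ] (⊤ : Submodule ℂ (Matrix ι ι ℂ)),
      Function.Injective ρ ∧ (∀ X, X ∈ Set.range ρ ↔ X.1.transpose = -X.1) ∧ IsTripleHom ρ ∧
      troGenerated (Set.range fun x : Z => (ρ x : Matrix ι ι ℂ)) = ⊤ ∧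
      ∀ i j, i ≠ j → (ρ (z (φ i) (φ j)) : Matrix ι ι ℂ) =
        Matrix.single i j 1 - Matrix.single j i 1 := by
  have hF := (hu.family hz).comp φ.injective
  obtain ⟨e, he⟩ := hF.exists_isUnitsOf hI
  have hT := hF.isTernaryUnits he hI
  have hue : ∀ i j, i ≠ j → (z (φ i) (φ j) : A) = e i j - e j i :=
    fun i j hij => hF.eq_unit_sub_unit he hI hij
  have hne : ∀ i j, e i j ≠ 0 := by
    intro i j h0
    obtain ⟨k, l, hkl, h⟩ := exists_ne_zero hspan hdim
    refine h ?_
    have := hue (φ.symm k) (φ.symm l) (φ.symm.injective.ne hkl)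
    rw [φ.apply_symm_apply, φ.apply_symm_apply, hT.eq_zero h0, hT.eq_zero h0, sub_zero] at this
    rw [← hz k l hkl, this]
  have hinj := hT.matrixMap_injective hne
  have hmem : Z ≤ LinearMap.range (matrixMap e) := by
    conv_lhs => rw [← hspan]
    rw [Submodule.span_le]
    rintro _ ⟨i, j, hij, rfl⟩
    obtain ⟨i, rfl⟩ := φ.surjective i
    obtain ⟨j, rfl⟩ := φ.surjective j
    refine ⟨Matrix.single i j 1 - Matrix.single j i 1, ?_⟩
    rw [← hz _ _ hij, hue i j (fun h => hij (congrArg φ h)), map_sub, matrixMap_single,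
      matrixMap_single, one_smul, one_smul]
  -- The representation is the inverse of the embedding `matrixMap e`, restricted to `Z`; identities
  -- for it are checked in `A` by injectivity.
  let ρ₀ : Z →ₗ[ℂ] Matrix ι ι ℂ :=
    (LinearEquiv.ofInjective (matrixMap e) hinj).symm.toLinearMap ∘ₗ Submodule.inclusion hmem
  have hρ₀ : ∀ x, matrixMap e (ρ₀ x) = x := fun x => by
    have := (LinearEquiv.ofInjective (matrixMap e) hinj).apply_symm_apply
      (Submodule.inclusion hmem x)
    exact congrArg Subtype.val this
  have hgrid : ∀ i j, i ≠ j → ρ₀ (z (φ i) (φ j)) = Matrix.single i j 1 - Matrix.single j i 1 := by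
    intro i j hij
    apply hinj
    rw [hρ₀, hue i j hij, map_sub, matrixMap_single, matrixMap_single, one_smul, one_smul]
  let ρ : Z →ₗ[ℂ] (⊤ : Submodule ℂ (Matrix ι ι ℂ)) := ρ₀.codRestrict ⊤ fun _ => trivial
  refine ⟨ρ, ?_, ?_, ?_, ?_, hgrid⟩
  · intro x y h
    have h1 : ρ₀ x = ρ₀ y := congrArg Subtype.val h
    apply Subtype.ext
    rw [← hρ₀ x, h1, hρ₀]
  · rintro ⟨X, hX⟩
    constructor
    · rintro ⟨x, hx⟩
      have hx : ρ₀ x = X := congrArg Subtype.val hx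
      change X.transpose = -X
      rw [← hx]
      have : (Matrix.transposeLinearEquiv ι ι ℂ ℂ).toLinearMap ∘ₗ ρ₀ = -ρ₀ := by
        refine linearMap_ext hspan hz fun i j hij => ?_
        obtain ⟨i, rfl⟩ := φ.surjective i
        obtain ⟨j, rfl⟩ := φ.surjective j
        simp [hgrid i j (fun h => hij (congrArg φ h))]
      exact LinearMap.congr_fun this x
    · intro h
      have h1 : X ∈ LinearMap.range ρ₀ := by
        refine mem_of_transpose_eq_neg (fun i j hij => ?_) h
        exact ⟨_, hgrid i j hij⟩
      obtain ⟨x, hx⟩ := h1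
      exact ⟨x, Subtype.ext hx⟩
  · intro x y w r h
    apply hinj
    rw [hT.matrixMap_jordanTriple]
    change matrixMap e (ρ₀ r) = jordanTriple (matrixMap e (ρ₀ x)) (matrixMap e (ρ₀ y))
      (matrixMap e (ρ₀ w))
    rw [hρ₀, hρ₀, hρ₀, hρ₀, h]
  · rw [eq_top_iff]
    have hsub := subset_troGenerated (Set.range fun x : Z => (ρ x : Matrix ι ι ℂ))
    have hsingle : ∀ i j, Matrix.single i j 1 ∈
        troGenerated (Set.range fun x : Z => (ρ x : Matrix ι ι ℂ)) := by
      intro i j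
      obtain ⟨k, h1, h2, -, -⟩ := hI i j i j
      obtain ⟨l, h3, h4, h5, -⟩ := hI i j k k
      have : Matrix.single i j 1 = ρ₀ (z (φ i) (φ k)) * star (ρ₀ (z (φ k) (φ l))) *
          ρ₀ (z (φ j) (φ l)) := by
        apply hinj
        rw [hT.matrixMap_mul, hρ₀, hρ₀, hρ₀, matrixMap_single, one_smul]
        exact he i j k l h5.symm h1 h2 h3 h4
      rw [this]
      exact (isTRO_troGenerated _).ternary_mem _ (hsub ⟨_, rfl⟩) _ (hsub ⟨_, rfl⟩) _
        (hsub ⟨_, rfl⟩)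
    intro X _
    rw [Matrix.matrix_eq_sum_single X]
    refine Submodule.sum_mem _ fun i _ => Submodule.sum_mem _ fun j _ => ?_
    have := Submodule.smul_mem _ (X i j) (hsingle i j)
    rwa [Matrix.smul_single, smul_eq_mul, mul_one] at this

/-- Every triple homomorphism into a TRO extends to the full matrix TRO, by means of a system of
matrix units. -/
theorem exists_units_lift (hu : IsSymplecticGrid Z u)
    (hspan : Submodule.span ℂ {x | ∃ i j, i ≠ j ∧ x = u i j} = Z)
    (hI : ∀ a b c d : ι, ∃ m, m ≠ a ∧ m ≠ b ∧ m ≠ c ∧ m ≠ d)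
    (hz : ∀ i j, i ≠ j → (z i j : A) = u i j) (φ : ι ≃ I)
    {ρ : Z →ₗ[ℂ] (⊤ : Submodule ℂ (Matrix ι ι ℂ))}
    (hρ : ∀ i j, i ≠ j → (ρ (z (φ i) (φ j)) : Matrix ι ι ℂ) =
        Matrix.single i j 1 - Matrix.single j i 1)
    {C : Type*} [NonUnitalCStarAlgebra C] {S : Submodule ℂ C} (hS : IsTRO S)
    {α : Z →ₗ[ℂ] S} (hα : IsTripleHom α) :
    ∃ e : ι → ι → C, IsTernaryUnits e ∧ (∀ X, matrixMap e X ∈ S) ∧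
      ∀ x : Z, matrixMap e (ρ x : Matrix ι ι ℂ) = α x := by
  have hF := (hu.isSymplecticFamily hα hz).comp φ.injective
  obtain ⟨e, he⟩ := hF.exists_isUnitsOf hI
  have hT := hF.isTernaryUnits he hI
  have hmem : LinearMap.range (matrixMap e) ≤ S := by
    rw [range_matrixMap, Submodule.span_le]
    rintro _ ⟨i, j, rfl⟩
    obtain ⟨k, h1, h2, -, -⟩ := hI i j i j
    obtain ⟨l, h3, h4, h5, -⟩ := hI i j k k
    rw [he i j k l h5.symm h1 h2 h3 h4]
    exact hS.ternary_mem _ (Subtype.mem _) _ (Subtype.mem _) _ (Subtype.mem _)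
  refine ⟨e, hT, fun X => hmem ⟨X, rfl⟩, fun x => ?_⟩
  have : matrixMap e ∘ₗ Submodule.subtype _ ∘ₗ ρ = S.subtype ∘ₗ α := by
    refine linearMap_ext hspan hz fun i j hij => ?_
    obtain ⟨i, rfl⟩ := φ.surjective i
    obtain ⟨j, rfl⟩ := φ.surjective j
    have hij' : i ≠ j := fun h => hij (congrArg φ h)
    simp only [LinearMap.comp_apply, Submodule.subtype_apply]
    rw [hρ i j hij', map_sub, matrixMap_single, matrixMap_single, one_smul, one_smul]
    exact (hF.eq_unit_sub_unit he hI hij').symm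
  exact LinearMap.congr_fun this x

end IsSymplecticGrid

/-! ### Universality and uniqueness -/

theorem isTRO_top {A : Type*} [NonUnitalCStarAlgebra A] : IsTRO (⊤ : Submodule ℂ A) :=
  ⟨isClosed_univ, fun _ _ _ _ _ _ => trivial⟩

theorem mainTheorem6 {A : Type u} [NonUnitalCStarAlgebra A] (Z : Submodule ℂ A)
    (hZ : IsJCTriple Z) {I : Type v} (u : I → I → A) (hu : IsSymplecticGrid Z u)
    (hspan : Submodule.span ℂ {x | ∃ i j, i ≠ j ∧ x = u i j} = Z)
    (hdim : 10 ≤ Module.finrank ℂ Z) :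
    -- the matrix units inside the TRO generated by the grid
    (∃ e : I → I → A,
      (∀ i k l, [i, k, l].Nodup → e i i = u i k * star (u k l) * u i l) ∧
      (∀ i j, i ≠ j → e i j = e i i * star (e i i) * u i j * star (e j j) * e j j) ∧
      IsSquareMatrixUnits (troGenerated {x | ∃ i j, i ≠ j ∧ x = u i j}) e) ∧
    -- the universal enveloping TRO of `Z` is the TRO of `n × n` matrices, `n` the size of `I`
    ∃ ρ : Z →ₗ[ℂ] (⊤ : Submodule ℂ (Matrix (Fin (Nat.card I)) (Fin (Nat.card I)) ℂ)),
      Function.Injective ρ ∧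
      (∀ X, X ∈ Set.range ρ ↔ X.1.transpose = -X.1) ∧
      IsUniversalEnvelopingTRO.{u, 0, w} Z ⊤ ρ ∧
      ∀ (B : Type t) [NonUnitalCStarAlgebra B] (T : Submodule ℂ B) (σ : Z →ₗ[ℂ] T),
        IsUniversalEnvelopingTRO.{u, t, w} Z T σ →
        ∃ f : T ≃ₗ[ℂ] (⊤ : Submodule ℂ (Matrix (Fin (Nat.card I)) (Fin (Nat.card I)) ℂ)),
          IsTROHom f.toLinearMap ∧ ∀ z : Z, f (σ z) = ρ z := by
  obtain ⟨hfin, hcard⟩ := hu.finite_and_five_le_card hspan hdim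
  refine ⟨hu.isSquareMatrixUnits hspan hdim (IsSymplecticGrid.exists_ne_of_five_le_card hcard), ?_⟩
  obtain ⟨z, hz⟩ := hu.exists_lift
  let φ : Fin (Nat.card I) ≃ I := (Finite.equivFin I).symm
  -- The lifting property of `σ` only tests targets in universe `w`; the lifted index type supplies
  -- a matrix algebra there.
  let ψ : ULift.{w} (Fin (Nat.card I)) ≃ I := Equiv.ulift.trans φ
  have hι := IsSymplecticGrid.exists_ne_of_five_le_card (J := Fin (Nat.card I))
    (by rwa [Nat.card_fin])
  have hκ := IsSymplecticGrid.exists_ne_of_five_le_card (J := ULift.{w} (Fin (Nat.card I)))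
    (by rwa [Nat.card_congr ψ])
  obtain ⟨ρ, hinj, hrange, htriple, hgen, hgrid⟩ := hu.exists_antisymmetric hspan hdim hι hz φ
  refine ⟨ρ, hinj, hrange, ⟨isTRO_top, htriple, hgen, ?_⟩, ?_⟩
  · intro C _ S hS α hα
    obtain ⟨e, he, hmem, hlift⟩ := hu.exists_units_lift hspan hι hz φ hgrid hS hα
    refine ⟨(matrixMap e ∘ₗ Submodule.subtype ⊤).codRestrict S fun X => hmem X, ?_, ?_⟩
    · intro x y r s h
      change matrixMap e (s : Matrix _ _ ℂ) = _
      rw [h]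
      exact he.matrixMap_mul _ _ _
    · exact fun x => Subtype.ext (hlift x)
  · intro B _ T σ hσ
    obtain ⟨e, he, hmem, hlift⟩ := hu.exists_units_lift hspan hι hz φ hgrid hσ.isTRO
      hσ.isTripleHom
    obtain ⟨a, b, hab, hne⟩ := IsSymplecticGrid.exists_ne_zero hspan hdim
    -- One vanishing unit would force `σ = 0`. But the injective representation `τ` factors through
    -- `σ`, and `Z` is nonzero.
    have he0 : ∀ i j, e i j ≠ 0 := by
      intro i j h0
      have hσ0 : ∀ x, σ x = 0 := fun x => by
        apply Subtype.ext
        rw [← hlift x]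
        change ∑ i, ∑ j, _ • e i j = _
        simp [he.eq_zero h0]
      obtain ⟨τ, hτinj, -, hτ, -, -⟩ := hu.exists_antisymmetric hspan hdim hκ hz ψ
      obtain ⟨f, -, hf⟩ := hσ.lift _ ⊤ isTRO_top τ hτ
      have h1 : z a b = 0 := by
        apply hτinj
        rw [← hf, hσ0, map_zero, map_zero]
      apply hne
      rw [← hz a b hab, h1]
      rfl
    -- Surjectivity: the range is a TRO containing the image of `σ`, which generates `T`.
    have hTle : T ≤ LinearMap.range (matrixMap e) := by
      conv_lhs => rw [← hσ.generated]
      refine troGenerated_le he.isTRO_range ?_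
      rintro _ ⟨x, rfl⟩
      exact ⟨_, hlift x⟩
    let g : (⊤ : Submodule ℂ (Matrix (Fin (Nat.card I)) (Fin (Nat.card I)) ℂ)) →ₗ[ℂ] T :=
      (matrixMap e ∘ₗ Submodule.subtype ⊤).codRestrict T fun X => hmem X
    have hg : ∀ X, (g X : B) = matrixMap e (X : Matrix _ _ ℂ) := fun _ => rfl
    have hbij : Function.Bijective g := by
      constructor
      · intro X Y h
        exact Subtype.ext (he.matrixMap_injective he0 (congrArg Subtype.val h))
      · rintro ⟨x, hx⟩
        obtain ⟨X, hX⟩ := hTle hx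
        exact ⟨⟨X, trivial⟩, Subtype.ext hX⟩
    let f := LinearEquiv.ofBijective g hbij
    have hf : ∀ x, matrixMap e (f.symm x : Matrix _ _ ℂ) = x := fun x =>
      congrArg Subtype.val (f.apply_symm_apply x)
    refine ⟨f.symm, ?_, ?_⟩
    · intro x y r s h
      apply he.matrixMap_injective he0
      change matrixMap e (f.symm s : Matrix _ _ ℂ) = matrixMap e
        ((f.symm x : Matrix _ _ ℂ) * star (f.symm y : Matrix _ _ ℂ) * (f.symm r : Matrix _ _ ℂ))
      rw [he.matrixMap_mul, hf, hf, hf, hf, h]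
    · intro x
      rw [LinearEquiv.symm_apply_eq]
      exact Subtype.ext (hlift x).symm
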